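/- Let $\Lambda$ be a left and right noetherian ring and write $\mathrm{Ext}^i(X)$ for $\mathrm{Ext}^i_\Lambda(X,\Lambda)$ when $X$ is a finitely generated left $\Lambda$-module, and for $\mathrm{Ext}^i_{\Lambda^{op}}(X,\Lambda)$ when $X$ is a finitely generated right $\Lambda$-module, i.e. a left $\Lambda^{op}$-module; it is regarded as a module over the opposite side through the action on $\Lambda$. The grade of such an $X$ is $\operatorname{grade}X=\inf\{i\ge 0\mid \mathrm{Ext}^i(X)\ne 0\}\in\{0,1,2,\dots,\infty\}$ and its strong grade is $\operatorname{s.grade}X=\inf\{\operatorname{grade}Y\mid Y\subseteq X \text{ a submodule}\}$. The transpose $\operatorname{Tr}C$ of a finitely generated module $C$ is the cokernel of $P_0^*\to P_1^*$, where $P_1\to P_0\to C\to 0$ is an exact sequence with $P_0,P_1$ finitely generated projective and $(\ )^*=\mathrm{Ext}^0$ is the dual; it is well defined up to projective direct summands. For $m\ge 0$ let $\mathcal F_m$ (resp. $\mathcal F_m^{op}$) be the class of all finitely generated left (resp. right) $\Lambda$-modules $C$ with $\mathrm{Ext}^i(\operatorname{Tr}C)=0$ for $1\le i\le m$. **Theorem.**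 Let $k,l,n\ge 0$ be integers with $k\ge n-1$. (1) If $\operatorname{s.grade}\mathrm{Ext}^1(C)\ge l$ for all $C\in\mathcal F_k$ and $\operatorname{s.grade}\mathrm{Ext}^1(C)\ge n$ for all $C\in\mathcal F_l^{op}$, then $\operatorname{s.grade}\mathrm{Ext}^1(C)\ge n$ for all $C\in\mathcal F_k$. (2) If $\operatorname{grade}\mathrm{Ext}^1(C)\ge l-1$ for all $C\in\mathcal F_k$ and $\operatorname{grade}\mathrm{Ext}^1(C)\ge n-1$ for all $C\in\mathcal F_l^{op}$, then $\operatorname{grade}\mathrm{Ext}^1(C)\ge n-1$ for all $C\in\mathcal F_k$. -/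

import Mathlib

/-!
Duality with respect to a noetherian ring, for left and right modules at once.

Right `Λ`-modules are modules over `Λᵐᵒᵖ`, and `Λ` is a module over both rings, with commuting
actions.  The definitions below take two rings `A`, `B` and an abelian group `U` on which both act
and the actions commute.  For `(A, B, U) = (Λ, Λᵐᵒᵖ, Λ)` they are the notions for left
`Λ`-modules, and for `(A, B, U) = (Λᵐᵒᵖ, Λ, Λ)` those for right `Λ`-modules
(that is, for `Λᵐᵒᵖ` in place of `Λ`).
-/

open CategoryTheory

universe u

noncomputable section

namespace TorsionfreeGrade

variable (A B U : Type u) [Ring A] [Ring B] [AddCommGroup U] [Module A U] [Module B U]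
  [SMulCommClass A B U]

/-- The endomorphism `u ↦ b • u` of the `A`-module `U`. -/
def actionHom (b : B) : ModuleCat.of A U ⟶ ModuleCat.of A U :=
  ModuleCat.ofHom
    { toFun := fun u => b • u
      map_add' := smul_add b
      map_smul' := fun a u => (smul_comm a b u).symm }

/-- The `B`-module structure on `Ext^n_A(X, U)` that comes from the action of `B` on the second
argument `U`. -/
@[reducible]
def extModuleStructure (n : ℕ) (X : ModuleCat.{u} A) :
    Module B (Abelian.Ext X (ModuleCat.of A U) n) where
  smul b x := x.comp (Abelian.Ext.mk₀ (actionHom A B U b)) (add_zero n)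
  one_smul x := by
    have h : actionHom A B U 1 = 𝟙 _ := by ext u; exact one_smul B u
    change x.comp (Abelian.Ext.mk₀ (actionHom A B U 1)) (add_zero n) = x
    rw [h, Abelian.Ext.comp_mk₀_id]
  mul_smul b c x := by
    have h : actionHom A B U (b * c) = actionHom A B U c ≫ actionHom A B U b := by
      ext u; exact mul_smul b c u
    change x.comp (Abelian.Ext.mk₀ (actionHom A B U (b * c))) (add_zero n) =
      (x.comp (Abelian.Ext.mk₀ (actionHom A B U c)) (add_zero n)).comp
        (Abelian.Ext.mk₀ (actionHom A B U b)) (add_zero n)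
    rw [h, ← Abelian.Ext.mk₀_comp_mk₀, Abelian.Ext.comp_assoc_of_third_deg_zero]
  smul_zero b := Abelian.Ext.zero_comp ..
  smul_add b x y := Abelian.Ext.add_comp ..
  add_smul b c x := by
    have h : actionHom A B U (b + c) = actionHom A B U b + actionHom A B U c := by
      ext u; exact add_smul b c u
    change x.comp (Abelian.Ext.mk₀ (actionHom A B U (b + c))) (add_zero n) =
      x.comp (Abelian.Ext.mk₀ (actionHom A B U b)) (add_zero n) +
        x.comp (Abelian.Ext.mk₀ (actionHom A B U c)) (add_zero n)
    rw [h, Abelian.Ext.mk₀_add, Abelian.Ext.comp_add]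
  zero_smul x := by
    have h : actionHom A B U 0 = 0 := by ext u; exact zero_smul B u
    change x.comp (Abelian.Ext.mk₀ (actionHom A B U 0)) (add_zero n) = 0
    rw [h, Abelian.Ext.mk₀_zero, Abelian.Ext.comp_zero]

/-- `Ext^n_A(X, U)` as a `B`-module. -/
def extModule (n : ℕ) (X : ModuleCat.{u} A) : ModuleCat.{u} B :=
  letI := extModuleStructure A B U n X
  ModuleCat.of B (Abelian.Ext X (ModuleCat.of A U) n)

/-- The grade `inf {i ≥ 0 | Ext^i_A(X, U) ≠ 0}`; it is `⊤` if there is no such `i`. -/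
def grade (X : ModuleCat.{u} A) : ℕ∞ :=
  sInf {d : ℕ∞ | ∃ i : ℕ, d = i ∧ Nontrivial (Abelian.Ext X (ModuleCat.of A U) i)}

/-- The strong grade: the infimum of the grades of all submodules. -/
def strongGrade (X : ModuleCat.{u} A) : ℕ∞ :=
  ⨅ Y : Submodule A X, grade A U (ModuleCat.of A Y)

/-- An exact sequence `P₁ → P₀ → C → 0` with `P₁`, `P₀` finitely generated projective. -/
structure ProjPresentation (C : ModuleCat.{u} A) where
  P₁ : ModuleCat.{u} A
  P₀ : ModuleCat.{u} A
  finite₁ : Module.Finite A P₁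
  finite₀ : Module.Finite A P₀
  projective₁ : Module.Projective A P₁
  projective₀ : Module.Projective A P₀
  d : P₁ →ₗ[A] P₀
  aug : P₀ →ₗ[A] C
  exact : Function.Exact d aug
  surjective : Function.Surjective aug

variable {A} in
/-- The transpose `Tr C`, computed from a presentation `P₁ → P₀ → C → 0`: the cokernel of
`Hom_A(P₀, U) → Hom_A(P₁, U)`, as a `B`-module. For `U = Λ` it depends on the presentation only
up to projective direct summands. -/
def ProjPresentation.transpose {C : ModuleCat.{u} A} (p : ProjPresentation A C) :
    ModuleCat.{u} B :=
  ModuleCat.of B ((p.P₁ →ₗ[A] U) ⧸ LinearMap.range (LinearMap.lcomp B U p.d))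

/-- `C` is finitely generated and `n`-torsionfree: `Ext^i_B(Tr C, U) = 0` for `1 ≤ i ≤ n`.
The presentation used to compute `Tr C` does not matter when `U = Λ`, as these groups do not see
projective direct summands of `Tr C`. -/
def IsTorsionfree (n : ℕ) (C : ModuleCat.{u} A) : Prop :=
  Module.Finite A C ∧ ∃ p : ProjPresentation A C, ∀ i : ℕ, 1 ≤ i → i ≤ n →
    Subsingleton (Abelian.Ext (p.transpose B U) (ModuleCat.of B U) i)

end TorsionfreeGrade

end

/-! Let C lie in F_k and put X = Tr C. Then Ext^1(C) is the kernel of X → X**, and Ext^j(X) = 0 for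
1 ≤ j ≤ k. For a submodule T of Ext^1(C), the vanishing of Ext^i(T) for i < n is proved by strong
induction on i. If i < l, it is the first hypothesis. If i ≥ l, put Q = X/T. As Ext^j(T) = 0 for j <
i ≤ k, the long exact sequence gives Ext^j(Q) = 0 for 1 ≤ j ≤ i and embeds Ext^i(T) in Ext^(i+1)(Q)
= Ext^1(Y), where Y is an i-th syzygy of Q (`exists_ext_embedding`). Each syzygy step across a
vanishing Ext^1 raises torsionfreeness by one (`exists_isTorsionfree_syzygy`), so Y lies in F_i^op,
hence in F_l^op. By the second hypothesis E = Ext^i(T) has grade at least n > i. A module of grade >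
i has no nonzero map to Ext^i(T) when grade T ≥ i (`extModule_linearMap_eq_zero`), so the identity
of E is zero.

For (2), T is all of Ext^1(C). Then Q is torsionless, which puts Y in F_(i+1)^op, and i + 1 ≤ k
makes the embedding an isomorphism, so that grade can replace strong grade. -/

noncomputable section

namespace TorsionfreeGrade

/-! ### Vanishing of Ext along short exact sequences -/

section ExactSequences

variable {R : Type u} [Ring R] {X Y Z : ModuleCat.{u} R}

/-- The short complex given by two linear maps whose composition is zero. -/
abbrev shortComplexOfExact (f : X →ₗ[R] Y) (g : Y →ₗ[R] Z) (h : Function.Exact f g) :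
    ShortComplex (ModuleCat.{u} R) :=
  ShortComplex.mk (ModuleCat.ofHom f) (ModuleCat.ofHom g) (by
    ext x; exact h.apply_apply_eq_zero x)

variable {f : X →ₗ[R] Y} {g : Y →ₗ[R] Z}

theorem shortExact_of_exact (hf : Function.Injective f) (h : Function.Exact f g)
    (hg : Function.Surjective g) : (shortComplexOfExact f g h).ShortExact where
  exact := (ShortComplex.ShortExact.moduleCat_exact_iff_function_exact _).2 h
  mono_f := (ModuleCat.mono_iff_injective _).2 hf
  epi_g := (ModuleCat.epi_iff_surjective _).2 hg

theorem subsingleton_ext_zero_iff {W V : ModuleCat.{u} R} :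
    Subsingleton (Abelian.Ext W V 0) ↔ ∀ φ : W →ₗ[R] V, φ = 0 := by
  rw [Abelian.Ext.homEquiv₀.subsingleton_congr]
  constructor
  · intro h φ
    have := Subsingleton.elim (ModuleCat.ofHom φ) 0
    exact congrArg ModuleCat.Hom.hom this
  · intro h
    refine ⟨fun a b => ?_⟩
    ext1
    rw [h a.hom, h b.hom]

/-- `Ext^(n+1)(Z, W)` vanishes if `Ext^n(X, W)` and `Ext^(n+1)(Y, W)` do. -/
theorem subsingleton_ext_of_left_middle (hf : Function.Injective f) (h : Function.Exact f g)
    (hg : Function.Surjective g) (W : ModuleCat.{u} R) (n : ℕ)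
    (hX : Subsingleton (Abelian.Ext X W n)) (hY : Subsingleton (Abelian.Ext Y W (n + 1))) :
    Subsingleton (Abelian.Ext Z W (n + 1)) := by
  refine subsingleton_of_forall_eq 0 fun x => ?_
  obtain ⟨y, rfl⟩ := Abelian.Ext.contravariant_sequence_exact₃ (shortExact_of_exact hf h hg) W x
    (hY.elim _ _) (add_comm 1 n)
  have : y = 0 := hX.elim _ _
  rw [this, Abelian.Ext.comp_zero]

/-- `Ext^n(W, Z)` vanishes if `Ext^n(W, Y)` and `Ext^(n+1)(W, X)` do. -/
theorem subsingleton_ext_of_middle_left (hf : Function.Injective f) (h : Function.Exact f g)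
    (hg : Function.Surjective g) (W : ModuleCat.{u} R) (n : ℕ)
    (hY : Subsingleton (Abelian.Ext W Y n)) (hX : Subsingleton (Abelian.Ext W X (n + 1))) :
    Subsingleton (Abelian.Ext W Z n) := by
  refine subsingleton_of_forall_eq 0 fun x => ?_
  obtain ⟨y, rfl⟩ := Abelian.Ext.covariant_sequence_exact₃ W (shortExact_of_exact hf h hg) x
    rfl (hX.elim _ _)
  have : y = 0 := hY.elim _ _
  rw [this, Abelian.Ext.zero_comp]

/-- `Ext^n(W, Y)` vanishes if `Ext^n(W, X)` and `Ext^n(W, Z)` do. -/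
theorem subsingleton_ext_of_left_right (hf : Function.Injective f) (h : Function.Exact f g)
    (hg : Function.Surjective g) (W : ModuleCat.{u} R) (n : ℕ)
    (hX : Subsingleton (Abelian.Ext W X n)) (hZ : Subsingleton (Abelian.Ext W Z n)) :
    Subsingleton (Abelian.Ext W Y n) := by
  refine subsingleton_of_forall_eq 0 fun x => ?_
  obtain ⟨y, rfl⟩ := Abelian.Ext.covariant_sequence_exact₂ W (shortExact_of_exact hf h hg) x
    (hZ.elim _ _)
  have : y = 0 := hX.elim _ _
  rw [this, Abelian.Ext.zero_comp]

theorem exists_extension_of_subsingleton_ext (hf : Function.Injective f)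
    (h : Function.Exact f g) (hg : Function.Surjective g) {W : ModuleCat.{u} R}
    (hZ : Subsingleton (Abelian.Ext Z W 1)) (φ : X →ₗ[R] W) :
    ∃ ψ : Y →ₗ[R] W, ψ ∘ₗ f = φ := by
  obtain ⟨y, hy⟩ := Abelian.Ext.contravariant_sequence_exact₁ (shortExact_of_exact hf h hg) W
    (Abelian.Ext.mk₀ (ModuleCat.ofHom φ)) (add_zero 1) (hZ.elim _ _)
  obtain ⟨ψ, rfl⟩ := (Abelian.Ext.mk₀_bijective _ _).2 y
  rw [Abelian.Ext.mk₀_comp_mk₀] at hy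
  exact ⟨ψ.hom, congrArg ModuleCat.Hom.hom ((Abelian.Ext.mk₀_bijective _ _).1 hy)⟩

theorem subsingleton_ext_one_of_extension (hf : Function.Injective f)
    (h : Function.Exact f g) (hg : Function.Surjective g) {W : ModuleCat.{u} R}
    (hY : Subsingleton (Abelian.Ext Y W 1))
    (hW : ∀ φ : X →ₗ[R] W, ∃ ψ : Y →ₗ[R] W, ψ ∘ₗ f = φ) :
    Subsingleton (Abelian.Ext Z W 1) := by
  refine subsingleton_of_forall_eq 0 fun x => ?_
  obtain ⟨y, rfl⟩ := Abelian.Ext.contravariant_sequence_exact₃ (shortExact_of_exact hf h hg) W x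
    (hY.elim _ _) (add_zero 1)
  obtain ⟨φ, rfl⟩ := (Abelian.Ext.mk₀_bijective _ _).2 y
  obtain ⟨ψ, hψ⟩ := hW φ.hom
  have : φ = (shortComplexOfExact f g h).f ≫ ModuleCat.ofHom ψ := by
    ext1; exact hψ.symm
  rw [this, ← Abelian.Ext.mk₀_comp_mk₀, ShortComplex.ShortExact.extClass_comp_assoc]

theorem subsingleton_ext_of_retract {W : ModuleCat.{u} R} (s : X →ₗ[R] Y) (r : Y →ₗ[R] X)
    (hrs : r ∘ₗ s = LinearMap.id) (n : ℕ) (hY : Subsingleton (Abelian.Ext W Y n)) :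
    Subsingleton (Abelian.Ext W X n) := by
  refine subsingleton_of_forall_eq 0 fun x => ?_
  have h : ModuleCat.ofHom s ≫ ModuleCat.ofHom r = 𝟙 X := by
    ext1; exact hrs
  have h0 : x.comp (Abelian.Ext.mk₀ (ModuleCat.ofHom s)) (add_zero n) = 0 := hY.elim _ _
  rw [← Abelian.Ext.comp_mk₀_id x, ← h, ← Abelian.Ext.mk₀_comp_mk₀,
    ← Abelian.Ext.comp_assoc_of_third_deg_zero, h0, Abelian.Ext.zero_comp]

theorem subsingleton_ext_of_linearEquiv {W : ModuleCat.{u} R} (e : X ≃ₗ[R] Y) (n : ℕ)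
    (hY : Subsingleton (Abelian.Ext Y W n)) : Subsingleton (Abelian.Ext X W n) := by
  refine subsingleton_of_forall_eq 0 fun x => ?_
  have h0 : (Abelian.Ext.mk₀ e.toModuleIso.inv).comp x (zero_add n) = 0 := hY.elim _ _
  rw [← Abelian.Ext.mk₀_id_comp x, ← e.toModuleIso.hom_inv_id,
    ← Abelian.Ext.mk₀_comp_mk₀_assoc, h0, Abelian.Ext.comp_zero]

theorem subsingleton_ext_pi {W V : ModuleCat.{u} R} (n : ℕ) (h : Subsingleton (Abelian.Ext W V n))
    (m : ℕ) : Subsingleton (Abelian.Ext W (ModuleCat.of R (Fin m → V)) n) := by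
  induction m with
  | zero =>
    refine subsingleton_of_forall_eq 0 fun x => ?_
    have : 𝟙 (ModuleCat.of R (Fin 0 → V)) = 0 :=
      ModuleCat.hom_ext (LinearMap.ext fun x => funext fun i => i.elim0)
    rw [← Abelian.Ext.comp_mk₀_id x, this, Abelian.Ext.mk₀_zero, Abelian.Ext.comp_zero]
  | succ m ih =>
    refine subsingleton_ext_of_left_right (X := V) (Z := ModuleCat.of R (Fin m → V))
      (f := LinearMap.single R (fun _ : Fin (m + 1) => V) 0)
      (g := LinearMap.funLeft R V Fin.succ) (fun a b hab => Pi.single_injective (0 : Fin (m + 1)) hab) ?_ ?_ W n h ih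
    · intro x
      constructor
      · intro hx
        refine ⟨x 0, ?_⟩
        ext i
        refine Fin.cases ?_ (fun j => ?_) i
        · simp
        · have := congrFun hx j
          rw [LinearMap.single_apply, Pi.single_eq_of_ne (Fin.succ_ne_zero j)]
          exact this.symm
      · rintro ⟨y, rfl⟩
        ext j
        rw [LinearMap.funLeft_apply, LinearMap.single_apply,
          Pi.single_eq_of_ne (Fin.succ_ne_zero j)]
        rfl
    · exact LinearMap.funLeft_surjective_of_injective R V _ (Fin.succ_injective m)

end ExactSequences

/-! ### Ext into the bimodule as a module over the other ring -/

section ExtModule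

variable {A B U : Type u} [Ring A] [Ring B] [AddCommGroup U] [Module A U] [Module B U]
  [SMulCommClass A B U] {X Y Z : ModuleCat.{u} A}

variable (B U) in
/-- The connecting map `Ext^n(X, U) → Ext^(n+1)(Z, U)` of a short exact sequence
`0 → X → Y → Z → 0`. -/
def extConnecting {f : X →ₗ[A] Y} {g : Y →ₗ[A] Z} (hf : Function.Injective f)
    (h : Function.Exact f g) (hg : Function.Surjective g) (n : ℕ) :
    extModule A B U n X →ₗ[B] extModule A B U (n + 1) Z :=
  letI := extModuleStructure A B U n X
  letI := extModuleStructure A B U (n + 1) Z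
  { toFun := fun x : Abelian.Ext X (ModuleCat.of A U) n =>
      ((shortExact_of_exact hf h hg).extClass.comp x (add_comm 1 n) :
        Abelian.Ext Z (ModuleCat.of A U) (n + 1))
    map_add' := fun _ _ => Abelian.Ext.comp_add ..
    map_smul' := fun _ _ => (Abelian.Ext.comp_assoc_of_third_deg_zero ..).symm }

theorem extConnecting_injective {f : X →ₗ[A] Y} {g : Y →ₗ[A] Z} (hf : Function.Injective f)
    (h : Function.Exact f g) (hg : Function.Surjective g) (n : ℕ)
    (hY : ∀ y : Abelian.Ext Y (ModuleCat.of A U) n,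
      (Abelian.Ext.mk₀ (ModuleCat.ofHom f)).comp y (zero_add n) = 0) :
    Function.Injective (extConnecting B U hf h hg n) := by
  refine (injective_iff_map_eq_zero _).2 fun x hx => ?_
  obtain ⟨y, rfl⟩ := Abelian.Ext.contravariant_sequence_exact₁ (shortExact_of_exact hf h hg) _
    x (add_comm 1 n) hx
  exact hY y

theorem extConnecting_surjective {f : X →ₗ[A] Y} {g : Y →ₗ[A] Z} (hf : Function.Injective f)
    (h : Function.Exact f g) (hg : Function.Surjective g) (n : ℕ)
    (hY : Subsingleton (Abelian.Ext Y (ModuleCat.of A U) (n + 1))) :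
    Function.Surjective (extConnecting B U hf h hg n) := fun x =>
  Abelian.Ext.contravariant_sequence_exact₃ (shortExact_of_exact hf h hg) _ x
    (hY.elim _ _) (add_comm 1 n)

variable (A B U) in
/-- `Hom(X, U) ≃ Ext^0(X, U)`. -/
def extZeroEquiv (X : ModuleCat.{u} A) : (X →ₗ[A] U) ≃ₗ[B] extModule A B U 0 X :=
  letI := extModuleStructure A B U 0 X
  let F : (X →ₗ[A] U) →ₗ[B] extModule A B U 0 X :=
    { toFun := fun φ => (Abelian.Ext.mk₀ (ModuleCat.ofHom φ) :
        Abelian.Ext X (ModuleCat.of A U) 0)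
      map_add' := fun φ ψ => Abelian.Ext.mk₀_add (ModuleCat.ofHom φ) (ModuleCat.ofHom ψ)
      map_smul' := fun b φ =>
        (Abelian.Ext.mk₀_comp_mk₀ (ModuleCat.ofHom φ) (actionHom A B U b)).symm }
  LinearEquiv.ofBijective F
    ((Abelian.Ext.mk₀_bijective X (ModuleCat.of A U)).comp
      (ModuleCat.homEquiv (M := X) (N := ModuleCat.of A U)).symm.bijective)

theorem extConnecting_extZeroEquiv_eq_zero_iff {f : X →ₗ[A] Y} {g : Y →ₗ[A] Z}
    (hf : Function.Injective f) (h : Function.Exact f g) (hg : Function.Surjective g)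
    (φ : X →ₗ[A] U) :
    extConnecting B U hf h hg 0 (extZeroEquiv A B U X φ) = 0 ↔
      ∃ ψ : Y →ₗ[A] U, ψ ∘ₗ f = φ := by
  constructor
  · intro hφ
    obtain ⟨y, hy⟩ := Abelian.Ext.contravariant_sequence_exact₁ (shortExact_of_exact hf h hg)
      (ModuleCat.of A U) (Abelian.Ext.mk₀ (ModuleCat.ofHom φ)) (add_zero 1) hφ
    obtain ⟨ψ, rfl⟩ := (Abelian.Ext.mk₀_bijective _ _).2 y
    rw [Abelian.Ext.mk₀_comp_mk₀] at hy
    exact ⟨ψ.hom, congrArg ModuleCat.Hom.hom ((Abelian.Ext.mk₀_bijective _ _).1 hy)⟩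
  · rintro ⟨ψ, rfl⟩
    change (shortExact_of_exact hf h hg).extClass.comp (Abelian.Ext.mk₀
      ((shortComplexOfExact f g h).f ≫ ModuleCat.ofHom ψ)) (add_zero 1) = 0
    rw [← Abelian.Ext.mk₀_comp_mk₀, ShortComplex.ShortExact.extClass_comp_assoc]

theorem le_grade_iff {n : ℕ} :
    (n : ℕ∞) ≤ grade A U X ↔
      ∀ i < n, Subsingleton (Abelian.Ext X (ModuleCat.of A U) i) := by
  rw [grade, le_sInf_iff]
  constructor
  · intro h i hi
    by_contra hc
    exact absurd (Nat.cast_le.1 (h i ⟨i, rfl, not_subsingleton_iff_nontrivial.1 hc⟩)) hi.not_ge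
  · rintro h _ ⟨i, rfl, hi⟩
    by_contra hc
    exact not_subsingleton_iff_nontrivial.2 hi (h i (Nat.cast_lt.1 (not_le.1 hc)))

theorem le_grade_add_one_iff {n : ℕ} :
    (n : ℕ∞) ≤ grade A U X + 1 ↔
      ∀ i, i + 1 < n → Subsingleton (Abelian.Ext X (ModuleCat.of A U) i) := by
  cases n with
  | zero => simp
  | succ n =>
    rw [Nat.cast_succ, ENat.add_le_add_iff_right ENat.one_ne_top, le_grade_iff]
    simp

end ExtModule

/-! ### Bimodules that are free of rank one on both sides -/

section Balanced

variable (A B U : Type u) [Ring A] [Ring B] [AddCommGroup U] [Module A U] [Module B U]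

/-- Some element of `U` is a basis of `U` over `A` and over `B`. If the two actions commute, `A` is
then the endomorphism ring of `U` over `B` and vice versa. -/
def IsBalanced : Prop :=
  ∃ e : U, Function.Bijective (fun a : A => a • e) ∧ Function.Bijective (fun b : B => b • e)

variable {A B U}

theorem IsBalanced.symm (h : IsBalanced A B U) : IsBalanced B A U :=
  let ⟨e, h₁, h₂⟩ := h
  ⟨e, h₂, h₁⟩

theorem IsBalanced.nonempty_linearEquiv (h : IsBalanced A B U) : Nonempty (A ≃ₗ[A] U) :=
  let ⟨e, h₁, _⟩ := h
  ⟨LinearEquiv.ofBijective (LinearMap.toSpanSingleton A U e) h₁⟩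

theorem IsBalanced.exists_smul [SMulCommClass A B U] (h : IsBalanced A B U) (g : U →ₗ[B] U) :
    ∃ a : A, ∀ x, g x = a • x := by
  obtain ⟨e, h₁, h₂⟩ := h
  obtain ⟨a, ha⟩ := h₁.2 (g e)
  refine ⟨a, fun x => ?_⟩
  obtain ⟨b, rfl⟩ := h₂.2 x
  change a • e = g e at ha
  change g (b • e) = a • b • e
  rw [map_smul, ← ha, smul_comm a b e]

end Balanced

/-! ### Duals of finitely generated projectives -/

section Dual

variable {A B U : Type u} [Ring A] [Ring B] [AddCommGroup U] [Module A U] [Module B U]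
  [SMulCommClass A B U]

variable (A U) in
/-- The homomorphisms to `U` separate the elements of `X`. -/
def IsTorsionless (X : Type u) [AddCommGroup X] [Module A X] : Prop :=
  ∀ x : X, (∀ φ : X →ₗ[A] U, φ x = 0) → x = 0

variable (P : Type u) [AddCommGroup P] [Module A P]

theorem exists_dual_basis [Module.Finite A P] [Module.Projective A P] :
    ∃ (m : ℕ) (p : Fin m → P) (f : Fin m → P →ₗ[A] A), ∀ x, ∑ i, f i x • p i = x := by
  obtain ⟨m, f, g, -, -, h⟩ := Module.Finite.exists_comp_eq_id_of_projective A P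
  exact ⟨m, fun i => f fun j => if i = j then 1 else 0, fun i => LinearMap.proj i ∘ₗ g, fun x =>
    (LinearMap.pi_apply_eq_sum_univ f (g x)).symm.trans (LinearMap.congr_fun h x)⟩

variable (A B U) in
theorem exists_dual_retract [Module.Finite A P] [Module.Projective A P] :
    ∃ (m : ℕ) (p : Fin m → P) (r : (Fin m → U) →ₗ[B] (P →ₗ[A] U)),
      ∀ φ : P →ₗ[A] U, r (fun i => φ (p i)) = φ := by
  obtain ⟨m, p, f, h⟩ := exists_dual_basis (A := A) P
  refine ⟨m, p,
    { toFun := fun v =>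
        { toFun := fun x => ∑ i, f i x • v i
          map_add' := fun x y => by simp [add_smul, Finset.sum_add_distrib]
          map_smul' := fun a x => by simp [mul_smul, Finset.smul_sum] }
      map_add' := fun v w => by ext x; simp [Finset.sum_add_distrib]
      map_smul' := fun b v => by ext x; simp [Finset.smul_sum, smul_comm] }, fun φ => ?_⟩
  ext x
  conv_rhs => rw [← h x]
  simp

theorem exists_dual_retract_linearMap [Module.Finite A P] [Module.Projective A P] :
    ∃ (m : ℕ) (s : (P →ₗ[A] U) →ₗ[B] (Fin m → U)) (r : (Fin m → U) →ₗ[B] (P →ₗ[A] U)),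
      r ∘ₗ s = LinearMap.id := by
  obtain ⟨m, p, r, h⟩ := exists_dual_retract A B U P
  exact ⟨m, { toFun := fun φ i => φ (p i), map_add' := fun _ _ => rfl,
              map_smul' := fun _ _ => rfl }, r, LinearMap.ext h⟩

theorem IsBalanced.finite_dual (h : IsBalanced A B U) [Module.Finite A P]
    [Module.Projective A P] : Module.Finite B (P →ₗ[A] U) := by
  obtain ⟨m, s, r, hrs⟩ := exists_dual_retract_linearMap (A := A) (B := B) (U := U) P
  obtain ⟨e⟩ := h.symm.nonempty_linearEquiv
  have := Module.Finite.equiv e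
  exact Module.Finite.of_surjective r fun x => ⟨s x, LinearMap.congr_fun hrs x⟩

theorem IsBalanced.projective_dual (h : IsBalanced A B U) [Module.Finite A P]
    [Module.Projective A P] : Module.Projective B (P →ₗ[A] U) := by
  obtain ⟨m, s, r, hrs⟩ := exists_dual_retract_linearMap (A := A) (B := B) (U := U) P
  obtain ⟨e⟩ := h.symm.nonempty_linearEquiv
  have : Module.Projective B (Fin m → U) :=
    Module.Projective.of_equiv (LinearEquiv.piCongrRight fun _ : Fin m => e)
  exact Module.Projective.of_split s r hrs

/-- Half of the reflexivity of P: the dual is a retract of U^m, and a `B`-linear functional on each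
factor U is the action of some `a i`, so the whole functional evaluates at `∑ i, a i • p i`. -/
theorem IsBalanced.exists_eq_eval (h : IsBalanced A B U) [Module.Finite A P]
    [Module.Projective A P] (g : (P →ₗ[A] U) →ₗ[B] U) : ∃ x : P, ∀ φ, g φ = φ x := by
  obtain ⟨m, p, r, hr⟩ := exists_dual_retract A B U P
  choose a ha using fun i => h.exists_smul (g ∘ₗ r ∘ₗ LinearMap.single B (fun _ => U) i)
  refine ⟨∑ i, a i • p i, fun φ => ?_⟩
  conv_lhs => rw [← hr φ, ← Finset.univ_sum_single fun i => φ (p i)]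
  rw [map_sum, map_sum, map_sum]
  refine Finset.sum_congr rfl fun i _ => ?_
  rw [map_smul]
  exact ha i (φ (p i))

omit [SMulCommClass A B U] in
theorem IsBalanced.isTorsionless_of_projective (h : IsBalanced A B U) [Module.Finite A P]
    [Module.Projective A P] : IsTorsionless A U P := by
  intro x hx
  obtain ⟨m, p, f, hf⟩ := exists_dual_basis (A := A) P
  obtain ⟨e⟩ := h.nonempty_linearEquiv
  rw [← hf x]
  refine Finset.sum_eq_zero fun i _ => ?_
  rw [e.map_eq_zero_iff.1 (hx (e.toLinearMap ∘ₗ f i)), zero_smul]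

theorem IsTorsionless.submodule {X : Type u} [AddCommGroup X] [Module A X]
    (h : IsTorsionless A U X) (Y : Submodule A X) : IsTorsionless A U Y := fun y hy =>
  Subtype.ext (h y fun φ => hy (φ ∘ₗ Y.subtype))

theorem subsingleton_ext_dual [Module.Finite A P] [Module.Projective A P] {E : ModuleCat.{u} B}
    (n : ℕ) (hE : Subsingleton (Abelian.Ext E (ModuleCat.of B U) n)) :
    Subsingleton (Abelian.Ext E (ModuleCat.of B (P →ₗ[A] U)) n) := by
  obtain ⟨m, s, r, hrs⟩ := exists_dual_retract_linearMap (A := A) (B := B) (U := U) P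
  exact subsingleton_ext_of_retract (X := ModuleCat.of B (P →ₗ[A] U))
    (Y := ModuleCat.of B (Fin m → U)) s r hrs n (subsingleton_ext_pi n hE m)

theorem subsingleton_ext_of_projective {R : Type u} [Ring R] (X Y : ModuleCat.{u} R)
    [Module.Projective R X] (n : ℕ) : Subsingleton (Abelian.Ext X Y (n + 1)) := by
  have := (IsProjective.iff_projective X).1 ‹_›
  exact Abelian.Ext.subsingleton_of_projective X Y n

end Dual

/-! ### The transpose, Ext^1 and syzygies -/

section Presentation

variable {A B U : Type u} [Ring A] [Ring B] [AddCommGroup U] [Module A U] [Module B U]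
  [SMulCommClass A B U]

namespace ProjPresentation

attribute [instance] finite₀ finite₁ projective₀ projective₁

variable {C : ModuleCat.{u} A} (p : ProjPresentation A C)

include p in
theorem finite : Module.Finite A C := Module.Finite.of_surjective p.aug p.surjective

theorem exact_range : Function.Exact (LinearMap.range p.d).subtype p.aug := by
  rw [LinearMap.exact_iff, Submodule.range_subtype]
  exact LinearMap.exact_iff.1 p.exact

theorem range_injective : Function.Injective (LinearMap.range p.d).subtype :=
  Subtype.val_injective

/-- The presentation of the syzygy `range p.d` with a free module over the kernel of `p.d`. -/
def syzygy {m : ℕ} (d : (Fin m → A) →ₗ[A] p.P₁) (hd : Function.Exact d p.d) :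
    ProjPresentation A (ModuleCat.of A (LinearMap.range p.d)) where
  P₁ := ModuleCat.of A (Fin m → A)
  P₀ := p.P₁
  finite₁ := inferInstanceAs (Module.Finite A (Fin m → A))
  finite₀ := p.finite₁
  projective₁ := inferInstanceAs (Module.Projective A (Fin m → A))
  projective₀ := p.projective₁
  d := d
  aug := p.d.rangeRestrict
  exact := by
    rw [LinearMap.exact_iff, LinearMap.ker_rangeRestrict]
    exact LinearMap.exact_iff.1 hd
  surjective := p.d.surjective_rangeRestrict

end ProjPresentation

theorem exists_exact_of_finite [IsNoetherianRing A] {M N : Type u} [AddCommGroup M] [Module A M]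
    [AddCommGroup N] [Module A N] [Module.Finite A M] (f : M →ₗ[A] N) :
    ∃ (m : ℕ) (d : (Fin m → A) →ₗ[A] M), Function.Exact d f := by
  obtain ⟨m, g, hg⟩ := Module.Finite.exists_fin' A (LinearMap.ker f)
  refine ⟨m, (LinearMap.ker f).subtype ∘ₗ g, ?_⟩
  rw [LinearMap.exact_iff, LinearMap.range_comp, LinearMap.range_eq_top.2 hg, Submodule.map_top,
    Submodule.range_subtype]

theorem nonempty_projPresentation [IsNoetherianRing A] (C : ModuleCat.{u} A)
    [Module.Finite A C] : Nonempty (ProjPresentation A C) := by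
  obtain ⟨n, g, hg⟩ := Module.Finite.exists_fin' A C
  obtain ⟨m, d, hd⟩ := exists_exact_of_finite g
  exact ⟨{
    P₁ := ModuleCat.of A (Fin m → A)
    P₀ := ModuleCat.of A (Fin n → A)
    finite₁ := inferInstanceAs (Module.Finite A (Fin m → A))
    finite₀ := inferInstanceAs (Module.Finite A (Fin n → A))
    projective₁ := inferInstanceAs (Module.Projective A (Fin m → A))
    projective₀ := inferInstanceAs (Module.Projective A (Fin n → A))
    d := d
    aug := g
    exact := hd
    surjective := hg }⟩

variable {C : ModuleCat.{u} A} (p : ProjPresentation A C)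

variable (B U) in
/-- The projection of `Hom(P₁, U)` to the transpose. -/
def transposeMk : (p.P₁ →ₗ[A] U) →ₗ[B] p.transpose B U :=
  (LinearMap.range (LinearMap.lcomp B U p.d)).mkQ

theorem transposeMk_surjective : Function.Surjective (transposeMk B U p) :=
  Submodule.mkQ_surjective _

theorem transposeMk_eq_zero_iff (φ : p.P₁ →ₗ[A] U) :
    transposeMk B U p φ = 0 ↔ ∃ ψ : p.P₀ →ₗ[A] U, ψ ∘ₗ p.d = φ :=
  Submodule.Quotient.mk_eq_zero _

/-- A functional on the image of P₀* in P₁* pulls back to evaluation at some x in P₀. It kills P₀* ∩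
C*, so every functional on C kills the image of x in C. Torsionlessness gives x = d y, and
evaluation at y is the required extension to P₁*. -/
theorem subsingleton_ext_one_transpose (h : IsBalanced A B U) (hC : IsTorsionless A U C) :
    Subsingleton (Abelian.Ext (p.transpose B U) (ModuleCat.of B U) 1) := by
  have := h.projective_dual p.P₁
  refine subsingleton_ext_one_of_extension
    (X := ModuleCat.of B (LinearMap.range (LinearMap.lcomp B U p.d)))
    (Y := ModuleCat.of B (p.P₁ →ₗ[A] U)) (W := ModuleCat.of B U)
    (f := (LinearMap.range (LinearMap.lcomp B U p.d)).subtype) (g := transposeMk B U p)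
    Subtype.val_injective ?_ (transposeMk_surjective p)
    (subsingleton_ext_of_projective (ModuleCat.of B (p.P₁ →ₗ[A] U)) _ 0) fun φ => ?_
  · rw [LinearMap.exact_iff, Submodule.range_subtype]
    exact Submodule.ker_mkQ _
  · obtain ⟨x, hx⟩ := h.exists_eq_eval p.P₀ (φ ∘ₗ (LinearMap.lcomp B U p.d).rangeRestrict)
    have hx0 : p.aug x = 0 := hC _ fun ψ => by
      have h0 : (LinearMap.lcomp B U p.d).rangeRestrict (ψ ∘ₗ p.aug) = 0 := by
        ext y
        change ψ (p.aug (p.d y)) = 0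
        rw [p.exact.apply_apply_eq_zero, map_zero]
      have := hx (ψ ∘ₗ p.aug)
      rw [LinearMap.comp_apply, h0, map_zero] at this
      exact this.symm
    obtain ⟨y, rfl⟩ := (p.exact x).1 hx0
    refine ⟨{ toFun := fun ψ => ψ y, map_add' := fun _ _ => rfl, map_smul' := fun _ _ => rfl }, ?_⟩
    ext ⟨_, ψ, rfl⟩
    exact (hx ψ).symm

/-- With K the image of d, Ext^1(C) is K* modulo the restrictions from P₀, and Tr C is P₁* modulo
the same functionals. The functionals in P₁* that come from K* are those that vanish on ker d. -/
theorem exists_ext_one_embedding :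
    ∃ j : extModule A B U 1 C →ₗ[B] p.transpose B U, Function.Injective j ∧
      ∀ φ : p.P₁ →ₗ[A] U, transposeMk B U p φ ∈ LinearMap.range j ↔
        ∀ x, p.d x = 0 → φ x = 0 := by
  let K := ModuleCat.of A (LinearMap.range p.d)
  let θ : (K →ₗ[A] U) →ₗ[B] extModule A B U 1 C :=
    extConnecting (X := K) B U p.range_injective p.exact_range p.surjective 0 ∘ₗ
      (extZeroEquiv A B U K).toLinearMap
  have hθ : Function.Surjective θ :=
    (extConnecting_surjective (X := K) p.range_injective p.exact_range p.surjective 0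
      (subsingleton_ext_of_projective p.P₀ _ 0)).comp (extZeroEquiv A B U K).surjective
  let ι : (K →ₗ[A] U) →ₗ[B] p.transpose B U :=
    transposeMk B U p ∘ₗ LinearMap.lcomp B U p.d.rangeRestrict
  have hker : LinearMap.ker θ = LinearMap.ker ι := by
    ext φ
    rw [LinearMap.mem_ker, LinearMap.mem_ker]
    refine (extConnecting_extZeroEquiv_eq_zero_iff (X := K) p.range_injective p.exact_range
      p.surjective φ).trans (Iff.trans ?_ (transposeMk_eq_zero_iff p _).symm)
    refine exists_congr fun ψ => ⟨?_, fun hψ => ?_⟩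
    · rintro rfl
      rfl
    · ext ⟨_, x, rfl⟩
      exact LinearMap.congr_fun hψ x
  let j : extModule A B U 1 C →ₗ[B] p.transpose B U :=
    (LinearMap.ker θ).liftQ ι hker.le ∘ₗ (θ.quotKerEquivOfSurjective hθ).symm.toLinearMap
  have hj : ∀ φ, j (θ φ) = ι φ := fun φ => by
    have : (θ.quotKerEquivOfSurjective hθ).symm (θ φ) = (LinearMap.ker θ).mkQ φ :=
      (LinearEquiv.symm_apply_eq _).2 rfl
    change (LinearMap.ker θ).liftQ ι hker.le ((θ.quotKerEquivOfSurjective hθ).symm (θ φ)) = _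
    rw [this]
    rfl
  refine ⟨j, (injective_iff_map_eq_zero j).2 fun t ht => ?_, fun φ => ⟨?_, fun hφ => ?_⟩⟩
  · obtain ⟨φ, rfl⟩ := hθ t
    rw [hj] at ht
    exact hker.ge ht
  · rintro ⟨t, ht⟩ x hx
    obtain ⟨ψ, rfl⟩ := hθ t
    rw [hj, ← sub_eq_zero] at ht
    change transposeMk B U p (ψ ∘ₗ p.d.rangeRestrict) - transposeMk B U p φ = 0 at ht
    rw [← map_sub, transposeMk_eq_zero_iff] at ht
    obtain ⟨χ, hχ⟩ := ht
    have h1 := LinearMap.congr_fun hχ x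
    have h2 : p.d.rangeRestrict x = 0 := Subtype.ext hx
    rw [LinearMap.comp_apply, hx, map_zero, LinearMap.sub_apply, LinearMap.comp_apply, h2,
      map_zero, zero_sub] at h1
    exact neg_eq_zero.1 h1.symm
  · have hle : LinearMap.ker p.d ≤ LinearMap.ker φ := hφ
    let ψ : K →ₗ[A] U :=
      (LinearMap.ker p.d).liftQ φ hle ∘ₗ p.d.quotKerEquivRange.symm.toLinearMap
    refine ⟨θ ψ, (hj ψ).trans (congrArg (transposeMk B U p) ?_)⟩
    ext x
    change (LinearMap.ker p.d).liftQ φ hle (p.d.quotKerEquivRange.symm (p.d.rangeRestrict x)) = _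
    have : p.d.quotKerEquivRange.symm (p.d.rangeRestrict x) = (LinearMap.ker p.d).mkQ x :=
      (LinearEquiv.symm_apply_eq _).2 rfl
    rw [this]
    rfl

/-- A functional on the transpose vanishes on `Ext^1(C, U)`. -/
theorem apply_eq_zero_of_mem_range (h : IsBalanced A B U)
    {j : extModule A B U 1 C →ₗ[B] p.transpose B U}
    (hj : ∀ φ : p.P₁ →ₗ[A] U, transposeMk B U p φ ∈ LinearMap.range j ↔
        ∀ x, p.d x = 0 → φ x = 0) (g : p.transpose B U →ₗ[B] U) (t : extModule A B U 1 C) :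
    g (j t) = 0 := by
  obtain ⟨φ, hφ⟩ := transposeMk_surjective p (j t)
  -- On P₁* the functional g is evaluation at some x. It kills the image of P₀*, so d x = 0, and
  -- representatives of Ext^1(C) vanish there.
  obtain ⟨x, hx⟩ := h.exists_eq_eval p.P₁ (g ∘ₗ transposeMk B U p)
  have hdx : p.d x = 0 := h.isTorsionless_of_projective p.P₀ _ fun ψ => by
    rw [← LinearMap.comp_apply, ← hx, LinearMap.comp_apply,
      (transposeMk_eq_zero_iff p _).2 ⟨ψ, rfl⟩, map_zero]
  rw [← hφ]
  exact (hx φ).trans ((hj φ).1 ⟨t, hφ.symm⟩ x hdx)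

/-- The quotient of the transpose by `Ext^1(C, U)` is torsionless. -/
theorem isTorsionless_quotient_range {j : extModule A B U 1 C →ₗ[B] p.transpose B U}
    (hj : ∀ φ : p.P₁ →ₗ[A] U, transposeMk B U p φ ∈ LinearMap.range j ↔
        ∀ x, p.d x = 0 → φ x = 0) :
    IsTorsionless B U (p.transpose B U ⧸ LinearMap.range j) := by
  intro y hy
  obtain ⟨x, rfl⟩ := Submodule.mkQ_surjective _ y
  obtain ⟨φ, rfl⟩ := transposeMk_surjective p x
  refine (Submodule.Quotient.mk_eq_zero _).2 ((hj φ).2 fun z hz => ?_)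
  -- Evaluation at a point of ker d descends to Tr C and then modulo Ext^1(C). These functionals
  -- already separate points.
  let ev : (p.P₁ →ₗ[A] U) →ₗ[B] U :=
    { toFun := fun ψ => ψ z, map_add' := fun _ _ => rfl, map_smul' := fun _ _ => rfl }
  let g : p.transpose B U →ₗ[B] U :=
    (LinearMap.range (LinearMap.lcomp B U p.d)).liftQ ev <| by
      rintro _ ⟨ψ, rfl⟩
      change ψ (p.d z) = 0
      rw [hz, map_zero]
  have hg : LinearMap.range j ≤ LinearMap.ker g := fun x hx => by
    obtain ⟨ψ, rfl⟩ := transposeMk_surjective p x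
    exact (hj ψ).1 hx z hz
  exact hy ((LinearMap.range j).liftQ g hg)

/-- If `Ext^1(C, U) = 0`, the transposes of `C` and of its first syzygy fit into a short exact
sequence with the dual of a finitely generated projective module in the middle. -/
theorem exists_syzygy_step [IsNoetherianRing A] (h : IsBalanced A B U)
    (hC : Subsingleton (Abelian.Ext C (ModuleCat.of A U) 1)) :
    ∃ (K : ModuleCat.{u} A) (q : ProjPresentation A K)
      (f : p.transpose B U →ₗ[B] (q.P₁ →ₗ[A] U)) (g : (q.P₁ →ₗ[A] U) →ₗ[B] q.transpose B U),
      Function.Injective f ∧ Function.Exact f g ∧ Function.Surjective g ∧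
      IsTorsionless A U K ∧
      ∀ n : ℕ, Nonempty (extModule A B U (n + 1) K ≃ₗ[B] extModule A B U (n + 2) C) := by
  obtain ⟨m, d, hd⟩ := exists_exact_of_finite p.d
  let f : p.transpose B U →ₗ[B] ((Fin m → A) →ₗ[A] U) :=
    (LinearMap.range (LinearMap.lcomp B U p.d)).liftQ (LinearMap.lcomp B U d) <| by
      rintro _ ⟨ψ, rfl⟩
      refine LinearMap.ext fun x => ?_
      change ψ (p.d (d x)) = 0
      rw [hd.apply_apply_eq_zero, map_zero]
  refine ⟨ModuleCat.of A (LinearMap.range p.d), p.syzygy d hd, f,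
    transposeMk B U (p.syzygy d hd), ?_, ?_, transposeMk_surjective _,
    (h.isTorsionless_of_projective p.P₀).submodule _, fun n => ⟨?_⟩⟩
  · refine (injective_iff_map_eq_zero f).2 fun x hx => ?_
    obtain ⟨φ, rfl⟩ := transposeMk_surjective p x
    -- A functional φ in the kernel of f factors through the syzygy, and Ext^1(C) = 0 extends it to
    -- P₀, so its class in Tr C is zero.
    have hle : LinearMap.ker p.d ≤ LinearMap.ker φ := fun y hy => by
      obtain ⟨z, rfl⟩ := (hd y).1 hy
      exact LinearMap.congr_fun hx z
    obtain ⟨ψ, hψ⟩ := exists_extension_of_subsingleton_ext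
      (X := ModuleCat.of A (LinearMap.range p.d)) (W := ModuleCat.of A U) p.range_injective
      p.exact_range p.surjective hC
      ((LinearMap.ker p.d).liftQ φ hle ∘ₗ p.d.quotKerEquivRange.symm.toLinearMap)
    refine (transposeMk_eq_zero_iff p φ).2 ⟨ψ, ?_⟩
    ext x
    refine (LinearMap.congr_fun hψ (p.d.rangeRestrict x)).trans ?_
    change (LinearMap.ker p.d).liftQ φ hle (p.d.quotKerEquivRange.symm (p.d.rangeRestrict x)) = _
    have : p.d.quotKerEquivRange.symm (p.d.rangeRestrict x) = (LinearMap.ker p.d).mkQ x :=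
      (LinearEquiv.symm_apply_eq _).2 rfl
    rw [this]
    rfl
  · intro φ
    refine (transposeMk_eq_zero_iff (p.syzygy d hd) φ).trans ⟨?_, ?_⟩
    · rintro ⟨ψ, rfl⟩
      exact ⟨transposeMk B U p ψ, rfl⟩
    · rintro ⟨x, rfl⟩
      obtain ⟨ψ, rfl⟩ := transposeMk_surjective p x
      exact ⟨ψ, rfl⟩
  · refine LinearEquiv.ofBijective
      (extConnecting (X := ModuleCat.of A (LinearMap.range p.d)) B U p.range_injective
        p.exact_range p.surjective (n + 1)) ⟨extConnecting_injective _ _ _ _ fun y => ?_,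
      extConnecting_surjective _ _ _ _ (subsingleton_ext_of_projective p.P₀ _ (n + 1))⟩
    rw [(subsingleton_ext_of_projective p.P₀ (ModuleCat.of A U) n).elim y 0,
      Abelian.Ext.comp_zero]

end Presentation

/-! ### Torsionfreeness of syzygies and maps into Ext -/

section Syzygies

variable {A B U : Type u} [Ring A] [Ring B] [AddCommGroup U] [Module A U] [Module B U]
  [SMulCommClass A B U]

theorem subsingleton_ext_of_extModule_linearEquiv {X Y : ModuleCat.{u} A} {m n : ℕ}
    (e : extModule A B U m X ≃ₗ[B] extModule A B U n Y)
    (h : Subsingleton (Abelian.Ext Y (ModuleCat.of A U) n)) :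
    Subsingleton (Abelian.Ext X (ModuleCat.of A U) m) :=
  have : Subsingleton (extModule A B U n Y) := h
  e.toEquiv.subsingleton

/-- Taking `i` syzygies of a module with `Ext^j(X, U) = 0` for `1 ≤ j ≤ i` makes it
torsionfree of degree raised by `i`. -/
theorem exists_isTorsionfree_syzygy [IsNoetherianRing A] (h : IsBalanced A B U) (i : ℕ) :
    ∀ (m : ℕ) {X : ModuleCat.{u} A} (p : ProjPresentation A X),
      (∀ j, 1 ≤ j → j ≤ m → Subsingleton (Abelian.Ext (p.transpose B U) (ModuleCat.of B U) j)) →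
      (∀ j, 1 ≤ j → j ≤ i → Subsingleton (Abelian.Ext X (ModuleCat.of A U) j)) →
      ∃ Y : ModuleCat.{u} A, IsTorsionfree A B U (m + i) Y ∧
        Nonempty (extModule A B U (i + 1) X ≃ₗ[B] extModule A B U 1 Y) := by
  induction i with
  | zero => exact fun m X p hp _ => ⟨X, ⟨p.finite, p, hp⟩, ⟨LinearEquiv.refl B _⟩⟩
  | succ i ih =>
    intro m X p hp hX
    obtain ⟨K, q, f, g, hf, hfg, hg, hK, e⟩ :=
      exists_syzygy_step (B := B) (U := U) p h (hX 1 le_rfl (by lia))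
    have := h.projective_dual q.P₁
    obtain ⟨Y, hY, ⟨e'⟩⟩ := ih (m + 1) q (fun j hj hjm => by
      -- Degree 1 is new and comes from K being torsionless; higher degrees are shifted up from Tr X
      -- along 0 → Tr X → P₁* → Tr K → 0, with P₁ taken from `q`.
      obtain rfl | ⟨j, rfl⟩ : j = 1 ∨ ∃ s, j = s + 2 :=
        (Nat.lt_or_ge 1 j).elim (fun h => .inr ⟨j - 2, by lia⟩) fun h => .inl (by lia)
      · exact subsingleton_ext_one_transpose q h hK
      · exact subsingleton_ext_of_left_middle (Y := ModuleCat.of B (q.P₁ →ₗ[A] U)) hf hfg hg _ _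
          (hp (j + 1) (by lia) (by lia))
          (subsingleton_ext_of_projective (ModuleCat.of B (q.P₁ →ₗ[A] U)) _ _)) fun j hj hji => by
      obtain ⟨j, rfl⟩ := Nat.exists_eq_add_of_le' hj
      obtain ⟨ej⟩ := e j
      exact subsingleton_ext_of_extModule_linearEquiv ej (hX (j + 2) (by lia) (by lia))
    obtain ⟨ei⟩ := e i
    refine ⟨Y, ?_, ⟨ei.symm.trans e'⟩⟩
    rwa [add_assoc, add_comm 1 i] at hY

/-- Ext^(i+1)(X) is Ext^1 of an i-th syzygy, hence lies in the transpose of that syzygy. Each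
passage from Tr X to Tr K costs one degree of vanishing of Ext(E, -), and after i of them Hom(E, -)
still vanishes. -/
theorem extModule_succ_linearMap_eq_zero [IsNoetherianRing A] (h : IsBalanced A B U)
    (E : ModuleCat.{u} B) (i : ℕ) :
    ∀ {X : ModuleCat.{u} A} (p : ProjPresentation A X),
      (∀ j ≤ i, Subsingleton (Abelian.Ext E (p.transpose B U) j)) →
      (∀ j ≤ i, Subsingleton (Abelian.Ext E (ModuleCat.of B U) j)) →
      (∀ j, 1 ≤ j → j ≤ i → Subsingleton (Abelian.Ext X (ModuleCat.of A U) j)) →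
      ∀ φ : E →ₗ[B] extModule A B U (i + 1) X, φ = 0 := by
  induction i with
  | zero =>
    intro X p hp _ _ φ
    obtain ⟨j, hj, -⟩ := exists_ext_one_embedding (B := B) (U := U) p
    have := subsingleton_ext_zero_iff.1 (hp 0 le_rfl) (j ∘ₗ φ)
    ext x
    exact hj ((LinearMap.congr_fun this x).trans (map_zero j).symm)
  | succ i ih =>
    intro X p hp hE hX φ
    obtain ⟨K, q, f, g, hf, hfg, hg, hK, e⟩ :=
      exists_syzygy_step (B := B) (U := U) p h (hX 1 le_rfl (by lia))
    obtain ⟨ei⟩ := e i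
    have := ih q (fun j hj => subsingleton_ext_of_middle_left
      (Y := ModuleCat.of B (q.P₁ →ₗ[A] U)) hf hfg hg E j
      (subsingleton_ext_dual q.P₁ j (hE j (by lia))) (hp (j + 1) (by lia)))
      (fun j hj => hE j (by lia)) (fun j hj hji => by
        obtain ⟨j, rfl⟩ := Nat.exists_eq_add_of_le' hj
        obtain ⟨ej⟩ := e j
        exact subsingleton_ext_of_extModule_linearEquiv ej (hX (j + 2) (by lia) (by lia)))
      (ei.symm.toLinearMap ∘ₗ φ)
    ext x
    exact ei.symm.map_eq_zero_iff.1 (LinearMap.congr_fun this x)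

/-- There are no nonzero maps from a module of grade greater than `i` to `Ext^i(T, U)` if `T` has
grade at least `i`. -/
theorem extModule_linearMap_eq_zero [IsNoetherianRing A] (h : IsBalanced A B U)
    (E : ModuleCat.{u} B) (T : ModuleCat.{u} A) [Module.Finite A T] (i : ℕ)
    (hE : ∀ j ≤ i, Subsingleton (Abelian.Ext E (ModuleCat.of B U) j))
    (hT : ∀ j < i, Subsingleton (Abelian.Ext T (ModuleCat.of A U) j))
    (φ : E →ₗ[B] extModule A B U i T) : φ = 0 := by
  cases i with
  | zero =>
    ext x
    refine (extZeroEquiv A B U T).symm.map_eq_zero_iff.1 (LinearMap.ext fun t => ?_)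
    let ev : (T →ₗ[A] U) →ₗ[B] U :=
      { toFun := fun ψ => ψ t, map_add' := fun _ _ => rfl, map_smul' := fun _ _ => rfl }
    exact LinearMap.congr_fun (subsingleton_ext_zero_iff.1 (hE 0 le_rfl)
      (ev ∘ₗ (extZeroEquiv A B U T).symm.toLinearMap ∘ₗ φ)) x
  | succ i =>
    obtain ⟨p⟩ := nonempty_projPresentation T
    have hT0 := subsingleton_ext_zero_iff.1 (hT 0 i.succ_pos)
    -- Since T* = 0, the sequence 0 → P₀* → P₁* → Tr T → 0 is exact; it transfers the vanishing for
    -- E from U to Tr T, one degree being lost.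
    have hinj : Function.Injective (LinearMap.lcomp B U p.d) := by
      refine (injective_iff_map_eq_zero _).2 fun ψ hψ => ?_
      have hle : LinearMap.ker p.aug ≤ LinearMap.ker ψ := fun y hy => by
        obtain ⟨z, rfl⟩ := (p.exact y).1 hy
        exact LinearMap.congr_fun hψ z
      have h0 := hT0 ((LinearMap.ker p.aug).liftQ ψ hle ∘ₗ
        (p.aug.quotKerEquivOfSurjective p.surjective).symm.toLinearMap)
      ext y
      have h1 := LinearMap.congr_fun h0 (p.aug y)
      have h2 : (p.aug.quotKerEquivOfSurjective p.surjective).symm (p.aug y) =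
        (LinearMap.ker p.aug).mkQ y := (LinearEquiv.symm_apply_eq _).2 rfl
      change (LinearMap.ker p.aug).liftQ ψ hle
        ((p.aug.quotKerEquivOfSurjective p.surjective).symm (p.aug y)) = 0 at h1
      rwa [h2] at h1
    refine extModule_succ_linearMap_eq_zero h E i p (fun j hj => ?_)
      (fun j hj => hE j (by lia)) (fun j _ hj => hT j (by lia)) φ
    exact subsingleton_ext_of_middle_left (X := ModuleCat.of B (p.P₀ →ₗ[A] U))
      (Y := ModuleCat.of B (p.P₁ →ₗ[A] U)) (Z := p.transpose B U)
      (f := LinearMap.lcomp B U p.d) (g := transposeMk B U p) hinj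
      (fun φ => transposeMk_eq_zero_iff p φ) (transposeMk_surjective p) E j
      (subsingleton_ext_dual p.P₁ j (hE j (by lia)))
      (subsingleton_ext_dual p.P₀ (j + 1) (hE (j + 1) (by lia)))

theorem IsTorsionfree.mono {m n : ℕ} (hmn : m ≤ n) {C : ModuleCat.{u} A}
    (h : IsTorsionfree A B U n C) : IsTorsionfree A B U m C :=
  let ⟨h₁, p, hp⟩ := h
  ⟨h₁, p, fun i hi him => hp i hi (him.trans hmn)⟩

variable (A B U) in
theorem finite_transpose (h : IsBalanced A B U) {C : ModuleCat.{u} A} (p : ProjPresentation A C) :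
    Module.Finite B (p.transpose B U) :=
  have := h.finite_dual p.P₁
  Module.Finite.of_surjective _ (transposeMk_surjective p)

theorem le_grade_of_le_strongGrade {n : ℕ} {E F : ModuleCat.{u} A} (f : E →ₗ[A] F)
    (hf : Function.Injective f) (h : (n : ℕ∞) ≤ strongGrade A U F) :
    ∀ i < n, Subsingleton (Abelian.Ext E (ModuleCat.of A U) i) := fun i hi =>
  subsingleton_ext_of_linearEquiv (Y := ModuleCat.of A (LinearMap.range f))
    (LinearEquiv.ofInjective f hf) i
    (le_grade_iff.1 (h.trans (iInf_le _ (LinearMap.range f))) i hi)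

end Syzygies

/-! ### Embedding Ext^i of a submodule into Ext^1 of a syzygy -/

section Extension

variable {A B U : Type u} [Ring A] [Ring B] [AddCommGroup U] [Module A U] [Module B U]
  [SMulCommClass A B U]

/-- Let `T` be a submodule of `X` killed by all maps `X → U`, such that `Ext^j(X, U) = 0` for
`1 ≤ j ≤ i` and `Ext^j(T, U) = 0` for `j < i`. Then `Ext^i(T, U)` embeds in `Ext^1(Y, U)` with `Y`
an `i`-th syzygy of `X / T`. -/
theorem exists_ext_embedding [IsNoetherianRing A] (h : IsBalanced A B U) {X T : ModuleCat.{u} A}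
    [Module.Finite A X] (f : T →ₗ[A] X) (hf : Function.Injective f)
    (hfU : ∀ φ : X →ₗ[A] U, φ ∘ₗ f = 0) (i m : ℕ)
    (hm : m = 0 ∨ m = 1 ∧ IsTorsionless A U (X ⧸ LinearMap.range f))
    (hX : ∀ j, 1 ≤ j → j ≤ i → Subsingleton (Abelian.Ext X (ModuleCat.of A U) j))
    (hT : ∀ j < i, Subsingleton (Abelian.Ext T (ModuleCat.of A U) j)) :
    ∃ Y : ModuleCat.{u} A, IsTorsionfree A B U (m + i) Y ∧
      ∃ j : extModule A B U i T →ₗ[B] extModule A B U 1 Y, Function.Injective j ∧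
        (Subsingleton (Abelian.Ext X (ModuleCat.of A U) (i + 1)) → Function.Surjective j) := by
  let Q := ModuleCat.of A (X ⧸ LinearMap.range f)
  have hex : Function.Exact f (LinearMap.range f).mkQ := by
    rw [LinearMap.exact_iff, Submodule.ker_mkQ]
  have hsurj := Submodule.mkQ_surjective (LinearMap.range f)
  have : Module.Finite A Q := Module.Finite.of_surjective _ hsurj
  obtain ⟨p⟩ := nonempty_projPresentation Q
  obtain ⟨Y, hY, ⟨e⟩⟩ := exists_isTorsionfree_syzygy (B := B) (U := U) h i m p
    (fun j hj hjm => by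
      obtain rfl | ⟨rfl, hQ⟩ := hm
      · lia
      · obtain rfl : j = 1 := by lia
        exact subsingleton_ext_one_transpose p h hQ)
    (fun j hj hji => by
      obtain ⟨j, rfl⟩ := Nat.exists_eq_add_of_le' hj
      exact subsingleton_ext_of_left_middle (Z := Q) hf hex hsurj _ j (hT j hji)
        (hX (j + 1) hj hji))
  refine ⟨Y, hY, e.toLinearMap ∘ₗ extConnecting (Z := Q) B U hf hex hsurj i,
    e.injective.comp (extConnecting_injective _ _ _ _ fun y => ?_), fun hX' =>
      e.surjective.comp (extConnecting_surjective (Z := Q) _ _ _ _ hX')⟩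
  -- Ext^0(X) need not vanish; for i = 0 it is the restriction X* → T* that is zero.
  rcases Nat.eq_zero_or_pos i with rfl | hi
  · obtain ⟨φ, rfl⟩ := (Abelian.Ext.mk₀_bijective _ _).2 y
    rw [Abelian.Ext.mk₀_comp_mk₀, Abelian.Ext.mk₀_eq_zero_iff]
    ext1
    exact hfU φ.hom
  · rw [(hX i hi le_rfl).elim y 0, Abelian.Ext.comp_zero]

end Extension

/-! ### The two inductions on the degree -/

section Main

variable {A B U : Type u} [Ring A] [Ring B] [AddCommGroup U] [Module A U] [Module B U]
  [SMulCommClass A B U] [SMulCommClass B A U]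

theorem le_strongGrade_ext_one [IsNoetherianRing B] (h : IsBalanced A B U) {k l n : ℕ}
    (hk : n ≤ k + 1)
    (hA : ∀ C : ModuleCat.{u} A, IsTorsionfree A B U k C →
      (l : ℕ∞) ≤ strongGrade B U (extModule A B U 1 C))
    (hB : ∀ C : ModuleCat.{u} B, IsTorsionfree B A U l C →
      (n : ℕ∞) ≤ strongGrade A U (extModule B A U 1 C))
    (C : ModuleCat.{u} A) (hC : IsTorsionfree A B U k C) :
    (n : ℕ∞) ≤ strongGrade B U (extModule A B U 1 C) := by
  refine le_iInf fun T => le_grade_iff.2 fun i => ?_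
  obtain ⟨-, p, hp⟩ := id hC
  obtain ⟨j, hj, hrange⟩ := exists_ext_one_embedding (B := B) (U := U) p
  have := finite_transpose A B U h p
  have hjT : Function.Injective (j ∘ₗ T.subtype) := hj.comp Subtype.val_injective
  have : Module.Finite B T := Module.Finite.of_injective _ hjT
  induction i using Nat.strong_induction_on with
  | _ i ih =>
    intro hi
    have hT : ∀ j < i, Subsingleton (Abelian.Ext (ModuleCat.of B T) (ModuleCat.of B U) j) :=
      fun j hji => ih j hji (hji.trans hi)
    rcases lt_or_ge i l with hil | hli
    · exact le_grade_iff.1 ((hA C hC).trans (iInf_le _ T)) i hil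
    -- For arbitrary T the quotient X/T need not be torsionless, so m = 0. Here f is only injective,
    -- which is why strong grade is needed.
    obtain ⟨Y, hY, f, hf, -⟩ := exists_ext_embedding (B := A) (T := ModuleCat.of B T) h.symm
      (j ∘ₗ T.subtype) hjT
      (fun φ => LinearMap.ext fun t => apply_eq_zero_of_mem_range p h hrange φ t) i 0 (.inl rfl)
      (fun j hj hji => hp j hj (by lia)) hT
    have hE := le_grade_of_le_strongGrade f hf (hB Y (hY.mono (by lia)))
    have h0 := extModule_linearMap_eq_zero h.symm _ (ModuleCat.of B T) i
      (fun j hj => hE j (by lia)) hT LinearMap.id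
    exact subsingleton_of_forall_eq 0 fun x => LinearMap.congr_fun h0 x

theorem le_grade_ext_one_add_one [IsNoetherianRing B] (h : IsBalanced A B U) {k l n : ℕ}
    (hk : n ≤ k + 1)
    (hA : ∀ C : ModuleCat.{u} A, IsTorsionfree A B U k C →
      (l : ℕ∞) ≤ grade B U (extModule A B U 1 C) + 1)
    (hB : ∀ C : ModuleCat.{u} B, IsTorsionfree B A U l C →
      (n : ℕ∞) ≤ grade A U (extModule B A U 1 C) + 1)
    (C : ModuleCat.{u} A) (hC : IsTorsionfree A B U k C) :
    (n : ℕ∞) ≤ grade B U (extModule A B U 1 C) + 1 := by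
  refine le_grade_add_one_iff.2 fun i => ?_
  obtain ⟨-, p, hp⟩ := id hC
  obtain ⟨j, hj, hrange⟩ := exists_ext_one_embedding (B := B) (U := U) p
  have := finite_transpose A B U h p
  have : Module.Finite B (extModule A B U 1 C) := Module.Finite.of_injective j hj
  induction i using Nat.strong_induction_on with
  | _ i ih =>
    intro hi
    have hT : ∀ j < i, Subsingleton (Abelian.Ext (extModule A B U 1 C) (ModuleCat.of B U) j) :=
      fun j hji => ih j hji (by lia)
    rcases lt_or_ge (i + 1) l with hil | hli
    · exact le_grade_add_one_iff.1 (hA C hC) i hil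
    obtain ⟨Y, hY, f, hf, hf'⟩ := exists_ext_embedding (B := A) h.symm j hj
      (fun φ => LinearMap.ext fun t => apply_eq_zero_of_mem_range p h hrange φ t) i 1
      (.inr ⟨rfl, isTorsionless_quotient_range p hrange⟩) (fun j hj hji => hp j hj (by lia)) hT
    -- Here i + 1 < n ≤ k + 1, so Ext^(i+1)(Tr C) = 0 and f is also surjective.
    have e := LinearEquiv.ofBijective f ⟨hf, hf' (hp (i + 1) (by lia) (by lia))⟩
    have h0 := extModule_linearMap_eq_zero h.symm _ (extModule A B U 1 C) i
      (fun j hj => subsingleton_ext_of_linearEquiv e j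
        (le_grade_add_one_iff.1 (hB Y (hY.mono (by lia))) j (by lia))) hT LinearMap.id
    exact subsingleton_of_forall_eq 0 fun x => LinearMap.congr_fun h0 x

theorem isBalanced_self (R : Type u) [Ring R] : IsBalanced R Rᵐᵒᵖ R :=
  ⟨1, Function.bijective_iff_has_inverse.2 ⟨id, fun a => mul_one a, fun a => mul_one a⟩,
    by simpa using MulOpposite.unop_bijective⟩

end Main

end TorsionfreeGrade

end

theorem theorem5p6 (Λ : Type u) [Ring Λ] [IsNoetherianRing Λ] [IsNoetherianRing Λᵐᵒᵖ]
    (k l n : ℕ) (hk : (k : ℤ) ≥ (n : ℤ) - 1) :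
    -- strong grade
    ((∀ C : ModuleCat.{u} Λ, TorsionfreeGrade.IsTorsionfree Λ Λᵐᵒᵖ Λ k C →
        (l : ℕ∞) ≤ TorsionfreeGrade.strongGrade Λᵐᵒᵖ Λ
          (TorsionfreeGrade.extModule Λ Λᵐᵒᵖ Λ 1 C)) →
      (∀ C : ModuleCat.{u} Λᵐᵒᵖ, TorsionfreeGrade.IsTorsionfree Λᵐᵒᵖ Λ Λ l C →
        (n : ℕ∞) ≤ TorsionfreeGrade.strongGrade Λ Λ
          (TorsionfreeGrade.extModule Λᵐᵒᵖ Λ Λ 1 C)) →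
      ∀ C : ModuleCat.{u} Λ, TorsionfreeGrade.IsTorsionfree Λ Λᵐᵒᵖ Λ k C →
        (n : ℕ∞) ≤ TorsionfreeGrade.strongGrade Λᵐᵒᵖ Λ
          (TorsionfreeGrade.extModule Λ Λᵐᵒᵖ Λ 1 C)) ∧
    -- grade; `g ≥ m - 1` is written `m ≤ g + 1`, which is also correct for `m = 0`
    ((∀ C : ModuleCat.{u} Λ, TorsionfreeGrade.IsTorsionfree Λ Λᵐᵒᵖ Λ k C →
        (l : ℕ∞) ≤ TorsionfreeGrade.grade Λᵐᵒᵖ Λ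
          (TorsionfreeGrade.extModule Λ Λᵐᵒᵖ Λ 1 C) + 1) →
      (∀ C : ModuleCat.{u} Λᵐᵒᵖ, TorsionfreeGrade.IsTorsionfree Λᵐᵒᵖ Λ Λ l C →
        (n : ℕ∞) ≤ TorsionfreeGrade.grade Λ Λ
          (TorsionfreeGrade.extModule Λᵐᵒᵖ Λ Λ 1 C) + 1) →
      ∀ C : ModuleCat.{u} Λ, TorsionfreeGrade.IsTorsionfree Λ Λᵐᵒᵖ Λ k C →
        (n : ℕ∞) ≤ TorsionfreeGrade.grade Λᵐᵒᵖ Λ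
          (TorsionfreeGrade.extModule Λ Λᵐᵒᵖ Λ 1 C) + 1) := by
  have h := TorsionfreeGrade.isBalanced_self Λ
  have hkn : n ≤ k + 1 := by lia
  exact ⟨TorsionfreeGrade.le_strongGrade_ext_one h hkn,
    TorsionfreeGrade.le_grade_ext_one_add_one h hkn⟩
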